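/- Let $r>0$, $\lambda>0$, $\mu_d\in\mathbb R$, $\sigma_d>0$, and assume $r_d:=r-\mu_d-\frac{\sigma_d^2}{2}>0$. On a probability space let $W$ be a standard real Brownian motion and let $\tau$ be a random variable, independent of $W$, with the exponential distribution of parameter (rate) $\lambda$. For $d\ge 0$ put $D^d(s)=d\,e^{\mu_d s+\sigma_d W(s)}$, and for $y_h,y_b\ge 0$ define $$w(y_h,y_b,d)=\mathbb E\Big[\int_0^\tau e^{-rs}\min\{D^d(s),\,y_h+y_b\}\,ds\Big].$$ Let $$m_1=\frac{-\mu_d-\sqrt{\mu_d^2+2(r+\lambda)\sigma_d^2}}{\sigma_d^2},\qquad m_2=\frac{-\mu_d+\sqrt{\mu_d^2+2(r+\lambda)\sigma_d^2}}{\sigma_d^2},$$ $$B_1=\frac{m_1\mu_d+m_1\sigma_d^2/2-r-\lambda}{(r+\lambda)(r_d+\lambda)(m_2-m_1)},\qquad C_1=\frac{m_2\mu_d+m_2\sigma_d^2/2-r-\lambda}{(r+\lambda)(r_d+\lambda)(m_2-m_1)}.$$ Then: 1. $m_1$ and $m_2$ are precisely the real roots of $\frac{\sigma_d^2}{2}x^2+\mu_d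 x-(r+\lambda)=0$, and $m_1<0$, $m_2>1$, $B_1<0$, $C_1<0$. 2. For all $y_h,y_b,d\ge 0$ the random variable $\int_0^\tau e^{-rs}\min\{D^d(s),y_h+y_b\}\,ds$ is integrable, and $$w(y_h,y_b,d)=\begin{cases}B_1(y_h+y_b)^{1-m_2}d^{m_2}+\dfrac{d}{r_d+\lambda}, & d<y_h+y_b,\\[2mm] C_1(y_h+y_b)^{1-m_1}d^{m_1}+\dfrac{y_h+y_b}{r+\lambda}, & d\ge y_h+y_b,\end{cases}$$ where for $y_h=y_b=d=0$ the second line is read as $0$. 3. $w$ is of class $C^2$, jointly in $(y_h,y_b,d)$, on the set $\{y_h\ge 0,\ y_b\ge 0,\ y_h+y_b>0,\ d>0\}$, in particular on the open octant $(0,\infty)^3$. -/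

import Mathlib

open MeasureTheory ProbabilityTheory
open scoped NNReal

noncomputable section

/-- The demand process `D^d(s) = d * exp (μ_d s + σ_d W(s))` at time `s`, on the path `ω`. -/
def demand {Ω : Type*} (W : ℝ≥0 → Ω → ℝ) (μd σd d : ℝ) (s : ℝ≥0) (ω : Ω) : ℝ :=
  d * Real.exp (μd * s + σd * W s ω)

/-- The discounted self-consumption `∫_0^τ e^{-rs} min {D^d(s), y_h + y_b} ds` on the path `ω`. -/
def discountedSharedEnergy {Ω : Type*} (W : ℝ≥0 → Ω → ℝ) (τ : Ω → ℝ)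
    (r μd σd yh yb d : ℝ) (ω : Ω) : ℝ :=
  ∫ s in (0 : ℝ)..τ ω,
    Real.exp (-r * s) * min (demand W μd σd d s.toNNReal ω) (yh + yb)

/-- The incentive function
`w(y_h, y_b, d) = E[∫_0^τ e^{-rs} min {D^d(s), y_h + y_b} ds]`. -/
def incentive {Ω : Type*} [MeasurableSpace Ω] (P : Measure Ω) (W : ℝ≥0 → Ω → ℝ) (τ : Ω → ℝ)
    (r μd σd yh yb d : ℝ) : ℝ :=
  ∫ ω, discountedSharedEnergy W τ r μd σd yh yb d ω ∂P

/-- The net discount rate `r_d = r - μ_d - σ_d² / 2`. -/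
def netRate (r μd σd : ℝ) : ℝ := r - μd - σd ^ 2 / 2

/-- The exponent `m₁`. -/
def mOne (r lam μd σd : ℝ) : ℝ :=
  (-μd - Real.sqrt (μd ^ 2 + 2 * (r + lam) * σd ^ 2)) / σd ^ 2

/-- The exponent `m₂`. -/
def mTwo (r lam μd σd : ℝ) : ℝ :=
  (-μd + Real.sqrt (μd ^ 2 + 2 * (r + lam) * σd ^ 2)) / σd ^ 2

/-- The constant `B₁`. -/
def constB (r lam μd σd : ℝ) : ℝ :=
  (mOne r lam μd σd * μd + mOne r lam μd σd * σd ^ 2 / 2 - r - lam) /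
    ((r + lam) * (netRate r μd σd + lam) * (mTwo r lam μd σd - mOne r lam μd σd))

/-- The constant `C₁`. -/
def constC (r lam μd σd : ℝ) : ℝ :=
  (mTwo r lam μd σd * μd + mTwo r lam μd σd * σd ^ 2 / 2 - r - lam) /
    ((r + lam) * (netRate r μd σd + lam) * (mTwo r lam μd σd - mOne r lam μd σd))

end

/-! ### Law of a drifted Brownian motion at an independent exponential time -/

section ExponentialMixture

open Set Complex

/-! Put `y = yh + yb` and `q = r + lam`. Killing at rate `lam` only raises the discount rate to `q`,
and `q e^{-qs}` is the density of an exponential time `T`. By Fubini, `w` is therefore `q⁻¹` times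
the mean of `min (d e^X) y`, with `X = μd T + σd B_T` (`incentive_eq_integral_exponentialTimeLaw`).

The characteristic function of `X` is `q` over a quadratic whose roots are governed by `m₁` and
`m₂`. Partial fractions identify `X` as asymmetric Laplace with rates `-m₁` and `m₂`
(`exponentialTimeLaw_eq_asymmetricLaplace`), and the mean becomes an integral of piecewise
exponentials (`integral_min_mul_exp_asymmetricLaplace`).

For smoothness, `w` is homogeneous of degree one, so `w = y g(log (d / y))`. The two exponential
branches of `g` agree to second order at `0` (`contDiffOn_homogeneous_ite`). -/

lemma integral_expMeasure {E : Type*} [NormedAddCommGroup E] [NormedSpace ℝ E] {r : ℝ}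
    (hr : 0 < r) (f : ℝ → E) :
    ∫ x, f x ∂expMeasure r = ∫ x in Ioi (0 : ℝ), (r * Real.exp (-(r * x))) • f x := by
  have hm : Measurable (gammaPDF 1 r) := (measurable_gammaPDFReal 1 r).ennreal_ofReal
  rw [← integral_Ici_eq_integral_Ioi, expMeasure, gammaMeasure,
    integral_withDensity_eq_integral_toReal_smul hm
      (ae_of_all _ fun x => (ENNReal.ofReal_lt_top : gammaPDF 1 r x < _)),
    ← integral_indicator measurableSet_Ici]
  refine integral_congr_ae (ae_of_all _ fun x => ?_)
  change (exponentialPDF r x).toReal • f x = _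
  rw [exponentialPDF_eq]
  by_cases hx : 0 ≤ x
  · rw [if_pos hx, indicator_of_mem (mem_Ici.2 hx),
      ENNReal.toReal_ofReal (mul_nonneg hr.le (Real.exp_pos _).le)]
  · rw [if_neg hx, indicator_of_notMem (by simpa using hx)]
    simp

lemma integral_expMeasure_cexp {r : ℝ} (hr : 0 < r) {z : ℂ} (hz : z.re < r) :
    ∫ x : ℝ, cexp (z * x) ∂expMeasure r = r / (r - z) := by
  have hne : (r : ℂ) - z ≠ 0 := fun h => by
    have := congrArg Complex.re h
    simp at this
    linarith
  rw [integral_expMeasure hr]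
  have : ∀ x : ℝ, (r * Real.exp (-(r * x))) • cexp (z * x) = r * cexp ((z - r) * x) := by
    intro x
    rw [Complex.real_smul]
    push_cast
    rw [mul_assoc, ← Complex.exp_add]
    ring_nf
  simp_rw [this]
  rw [integral_const_mul, integral_exp_mul_complex_Ioi (by simpa using hz)]
  have hne' : z - (r : ℂ) ≠ 0 := fun h => hne (by linear_combination -h)
  simp only [ofReal_zero, mul_zero, Complex.exp_zero]
  field_simp
  ring

lemma charFun_expMeasure {r : ℝ} (hr : 0 < r) (t : ℝ) :
    charFun (expMeasure r) t = r / (r - t * I) := by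
  rw [charFun_apply_real, ← integral_expMeasure_cexp hr (by simpa using hr)]
  simp_rw [mul_right_comm]

/-- The asymmetric Laplace law with rate `a` on the negative and `b` on the positive half-line. -/
noncomputable def asymmetricLaplace (a b : ℝ) : Measure ℝ :=
  (b / (a + b)).toNNReal • (expMeasure a).map (fun x => -x) +
    (a / (a + b)).toNNReal • expMeasure b

instance isFiniteMeasure_asymmetricLaplace {a b : ℝ} [IsFiniteMeasure (expMeasure a)]
    [IsFiniteMeasure (expMeasure b)] : IsFiniteMeasure (asymmetricLaplace a b) := by
  unfold asymmetricLaplace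
  infer_instance

lemma integral_asymmetricLaplace {E : Type*} [NormedAddCommGroup E] [NormedSpace ℝ E] {a b : ℝ}
    (ha : 0 < a) (hb : 0 < b) {f : ℝ → E} (hf : Integrable (fun x => f (-x)) (expMeasure a))
    (hf' : Integrable f (expMeasure b)) :
    ∫ x, f x ∂asymmetricLaplace a b =
      (b / (a + b)) • ∫ x, f (-x) ∂expMeasure a + (a / (a + b)) • ∫ x, f x ∂expMeasure b := by
  have e : MeasurableEmbedding (fun x : ℝ => -x) := (MeasurableEquiv.neg ℝ).measurableEmbedding
  have h1 : Integrable f ((b / (a + b)).toNNReal • (expMeasure a).map (fun x => -x)) :=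
    Integrable.smul_measure_nnreal (e.integrable_map_iff.2 hf)
  rw [asymmetricLaplace, integral_add_measure h1 hf'.smul_measure_nnreal,
    integral_smul_nnreal_measure, integral_smul_nnreal_measure, e.integral_map,
    NNReal.smul_def, NNReal.smul_def, Real.coe_toNNReal _ (by positivity),
    Real.coe_toNNReal _ (by positivity)]

/-- The law of `μ T + σ B_T` for a Brownian motion `B` and an independent exponential time `T`. -/
noncomputable def exponentialTimeLaw (q μ σ : ℝ) : Measure ℝ :=
  ((expMeasure q).prod (gaussianReal 0 1)).map (fun p => μ * p.1 + σ * (√p.1 * p.2))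

lemma integral_exponentialTimeLaw {E : Type*} [NormedAddCommGroup E] [NormedSpace ℝ E]
    {q : ℝ} (hq : 0 < q) (μ σ : ℝ) {f : ℝ → E}
    (hf : StronglyMeasurable f) {C : ℝ} (hC : ∀ x, ‖f x‖ ≤ C) :
    ∫ x, f x ∂exponentialTimeLaw q μ σ =
      ∫ s, ∫ x, f (μ * s + σ * x) ∂gaussianReal 0 s.toNNReal ∂expMeasure q := by
  have := isProbabilityMeasure_expMeasure hq
  have hm : Measurable (fun p : ℝ × ℝ => μ * p.1 + σ * (√p.1 * p.2)) := by fun_prop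
  rw [exponentialTimeLaw, integral_map hm.aemeasurable hf.aestronglyMeasurable, integral_prod]
  · refine integral_congr_ae (ae_of_all _ fun s => ?_)
    have h := gaussianReal_map_const_mul (μ := 0) (v := 1) (√s)
    have h2 : (⟨√s ^ 2, sq_nonneg _⟩ : ℝ≥0) * 1 = s.toNNReal := by
      ext
      by_cases hs : 0 ≤ s
      · simp [Real.sq_sqrt hs, hs]
      · simp [Real.sqrt_eq_zero_of_nonpos (not_le.1 hs).le, (not_le.1 hs).le]
    rw [mul_zero] at h
    erw [h2] at h
    dsimp only
    have hg : StronglyMeasurable fun x => f (μ * s + σ * x) :=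
      hf.comp_measurable (g := fun x => μ * s + σ * x) (by fun_prop)
    rw [← h, integral_map (by fun_prop) hg.aestronglyMeasurable]
  · exact Integrable.of_bound (hf.comp_measurable hm).aestronglyMeasurable C
      (ae_of_all _ fun p => hC _)

/-- Given `T = s`, the Gaussian characteristic function gives `e^{zs}` with `z = iμt - σ²t²/2`.
Since `Re z ≤ 0 < q`, averaging over `T` gives `q / (q - z)`. -/
lemma charFun_exponentialTimeLaw {q : ℝ} (hq : 0 < q) (μ σ t : ℝ) :
    charFun (exponentialTimeLaw q μ σ) t = q / (q - (μ * t * I - σ ^ 2 * t ^ 2 / 2)) := by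
  rw [charFun_apply_real, integral_exponentialTimeLaw hq μ σ (C := 1)]
  · rw [← integral_expMeasure_cexp hq, integral_expMeasure hq, integral_expMeasure hq]
    · refine setIntegral_congr_fun measurableSet_Ioi fun s hs => ?_
      congr 1
      have h := charFun_gaussianReal (μ := 0) (v := s.toNNReal) (t * σ)
      rw [charFun_apply_real] at h
      have h2 : ∀ x : ℝ, cexp (t * (μ * s + σ * x : ℝ) * I) =
          cexp (t * μ * s * I) * cexp ((t * σ : ℝ) * x * I) := by
        intro x
        rw [← Complex.exp_add]
        push_cast
        ring_nf
      simp_rw [h2]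
      rw [integral_const_mul, h, ← Complex.exp_add]
      congr 1
      have : ((s.toNNReal : ℝ) : ℂ) = s := by rw [Real.coe_toNNReal _ (le_of_lt hs)]
      rw [this]
      push_cast
      ring
    · have : (μ * t * I - σ ^ 2 * t ^ 2 / 2 : ℂ) = ((- (σ ^ 2 * t ^ 2 / 2) : ℝ) : ℂ) +
          (μ * t : ℝ) * I := by push_cast; ring
      rw [this]
      simp only [add_re, ofReal_re, mul_re, ofReal_im, I_re, I_im]
      nlinarith [sq_nonneg (σ * t)]
  · exact (by fun_prop : Continuous fun x : ℝ => cexp (t * x * I)).stronglyMeasurable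
  · intro x
    rw [← ofReal_mul, norm_exp_ofReal_mul_I]

/-- The hypotheses are Vieta's relations for roots `-a` and `b` of `σ²x²/2 + μx - q`. At `x = it`
this factors the denominator of the characteristic function, leaving `ab / ((a + it)(b - it))`,
whose partial fractions are the two exponential components. -/
lemma exponentialTimeLaw_eq_asymmetricLaplace {q μ σ a b : ℝ} (hq : 0 < q) (ha : 0 < a)
    (hb : 0 < b) (hab : σ ^ 2 / 2 * (a * b) = q) (hba : σ ^ 2 / 2 * (a - b) = μ) :
    exponentialTimeLaw q μ σ = asymmetricLaplace a b := by
  have := isProbabilityMeasure_expMeasure hq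
  have := isProbabilityMeasure_expMeasure ha
  have := isProbabilityMeasure_expMeasure hb
  have : IsFiniteMeasure (exponentialTimeLaw q μ σ) := by
    unfold exponentialTimeLaw; infer_instance
  refine Measure.ext_of_charFun (funext fun t => ?_)
  have hint : ∀ s : ℝ, ∀ ν : Measure ℝ, IsFiniteMeasure ν →
      Integrable (fun x : ℝ => cexp (s * x * I)) ν := fun s ν _ =>
    Integrable.of_bound (by fun_prop) 1
      (ae_of_all _ fun x => by rw [← ofReal_mul, norm_exp_ofReal_mul_I])
  have hneg : ∀ x : ℝ, cexp (t * (-x : ℝ) * I) = cexp ((-t : ℝ) * x * I) := fun x => by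
    push_cast; ring_nf
  rw [charFun_exponentialTimeLaw hq, charFun_apply_real, integral_asymmetricLaplace ha hb
    (by simp_rw [hneg]; exact hint _ _ inferInstance) (hint _ _ inferInstance)]
  simp_rw [hneg]
  rw [← charFun_apply_real, ← charFun_apply_real, charFun_expMeasure ha, charFun_expMeasure hb,
    Complex.real_smul, Complex.real_smul]
  have h0 : (a : ℂ) + b ≠ 0 := by exact_mod_cast (add_pos ha hb).ne'
  have h1 : (a : ℂ) - (-t : ℝ) * I ≠ 0 := fun h => by
    simpa [ha.ne'] using congrArg Complex.re h
  have h2 : (b : ℂ) - t * I ≠ 0 := fun h => by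
    simpa [hb.ne'] using congrArg Complex.re h
  have h3 : (q : ℂ) - (μ * t * I - σ ^ 2 * t ^ 2 / 2) =
      σ ^ 2 / 2 * ((a - (-t : ℝ) * I) * (b - t * I)) := by
    rw [← hab, ← hba]
    push_cast
    linear_combination ((σ : ℂ) ^ 2 * t ^ 2 / 2) * I_sq
  -- A vanishing `σ` would force `q = 0` by `hab`.
  have h4 : (σ : ℂ) ^ 2 / 2 ≠ 0 := fun h => by
    have : (q : ℂ) = σ ^ 2 / 2 * (a * b) := by rw [← hab]; push_cast; ring
    rw [h, zero_mul] at this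
    exact hq.ne' (by exact_mod_cast this)
  rw [h3, ← hab]
  push_cast at h1 ⊢
  rw [neg_mul, sub_neg_eq_add] at h1 ⊢
  rw [div_eq_iff (mul_ne_zero h4 (mul_ne_zero h1 h2))]
  field_simp
  ring

end ExponentialMixture

/-! ### The characteristic quadratic and its constants -/

section Roots

variable {r lam μd σd : ℝ}

lemma mOne_add_mTwo (hσd : 0 < σd) :
    mOne r lam μd σd + mTwo r lam μd σd = -2 * μd / σd ^ 2 := by
  unfold mOne mTwo
  field_simp
  ring

lemma mOne_mul_mTwo (hq : 0 < r + lam) (hσd : 0 < σd) :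
    mOne r lam μd σd * mTwo r lam μd σd = -2 * (r + lam) / σd ^ 2 := by
  have h := Real.sq_sqrt (show 0 ≤ μd ^ 2 + 2 * (r + lam) * σd ^ 2 by positivity)
  unfold mOne mTwo
  field_simp
  linear_combination -h

lemma mOne_lt_mTwo (hq : 0 < r + lam) (hσd : 0 < σd) :
    mOne r lam μd σd < mTwo r lam μd σd := by
  have h := Real.sqrt_pos.2 (show 0 < μd ^ 2 + 2 * (r + lam) * σd ^ 2 by positivity)
  exact div_lt_div_of_pos_right (by linarith) (by positivity)

lemma characteristic_eq_mul (hq : 0 < r + lam) (hσd : 0 < σd) (x : ℝ) :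
    σd ^ 2 / 2 * x ^ 2 + μd * x - (r + lam) =
      σd ^ 2 / 2 * ((x - mOne r lam μd σd) * (x - mTwo r lam μd σd)) := by
  have hs := mOne_add_mTwo (r := r) (lam := lam) (μd := μd) hσd
  have hp := mOne_mul_mTwo (r := r) (lam := lam) (μd := μd) hq hσd
  field_simp at hs hp
  linear_combination (x / 2) * hs - hp / 2

lemma characteristic_eq_zero_iff (hq : 0 < r + lam) (hσd : 0 < σd) (x : ℝ) :
    σd ^ 2 / 2 * x ^ 2 + μd * x - (r + lam) = 0 ↔
      x = mOne r lam μd σd ∨ x = mTwo r lam μd σd := by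
  rw [characteristic_eq_mul hq hσd, mul_eq_zero, mul_eq_zero, sub_eq_zero, sub_eq_zero,
    or_iff_right (by positivity)]

lemma mOne_neg (hq : 0 < r + lam) (hσd : 0 < σd) : mOne r lam μd σd < 0 := by
  have hp := mOne_mul_mTwo (r := r) (lam := lam) (μd := μd) hq hσd
  have hlt := mOne_lt_mTwo (r := r) (lam := lam) (μd := μd) hq hσd
  have : -2 * (r + lam) / σd ^ 2 < 0 := div_neg_of_neg_of_pos (by linarith) (by positivity)
  by_contra! h
  nlinarith [mul_nonneg h (h.trans hlt.le)]

/-- The quadratic at `1` equals `-(r_d + λ) < 0`, so `1` lies strictly between the roots. -/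
lemma one_lt_mTwo (hq : 0 < r + lam) (hσd : 0 < σd) (hd : 0 < netRate r μd σd + lam) :
    1 < mTwo r lam μd σd := by
  have h := characteristic_eq_mul (μd := μd) hq hσd 1
  have h1 := mOne_neg (μd := μd) hq hσd
  unfold netRate at hd
  by_contra! h2
  have := mul_nonneg (show 0 ≤ 1 - mOne r lam μd σd by linarith) (sub_nonneg.2 h2)
  nlinarith [mul_nonneg (show 0 ≤ σd ^ 2 / 2 by positivity) this]

/-- The root equation turns the numerator into `σ²m(1 - m)/2`, and the quadratic at `1` rewrites
`r_d + λ`, so `σ²` cancels. In this form the sign is visible and later identities are rational in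
the two roots. -/
lemma constB_eq (hq : 0 < r + lam) (hσd : 0 < σd) (hd : 0 < netRate r μd σd + lam) :
    constB r lam μd σd = mOne r lam μd σd * mTwo r lam μd σd /
      ((r + lam) * (mTwo r lam μd σd - mOne r lam μd σd) *
        (mTwo r lam μd σd * (mTwo r lam μd σd - 1))) := by
  have h1 := mOne_neg (μd := μd) hq hσd
  have h2 := one_lt_mTwo hq hσd hd
  have e := characteristic_eq_mul (μd := μd) hq hσd 1
  have e1 := (characteristic_eq_zero_iff (μd := μd) hq hσd (mOne r lam μd σd)).2 (Or.inl rfl)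
  have hd' : netRate r μd σd + lam = -(σd ^ 2 / 2 * 1 ^ 2 + μd * 1 - (r + lam)) := by
    unfold netRate; ring
  rw [e] at hd'
  unfold constB
  rw [hd']
  generalize mOne r lam μd σd = m at *
  generalize mTwo r lam μd σd = n at *
  have : m * μd + m * σd ^ 2 / 2 - r - lam = σd ^ 2 / 2 * (m * (1 - m)) := by
    linear_combination e1
  rw [this]
  have : n - m ≠ 0 := by linarith
  have : n - 1 ≠ 0 := by linarith
  have : 1 - n ≠ 0 := by linarith
  have : 1 - m ≠ 0 := by linarith
  have : n ≠ 0 := by linarith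
  field_simp
  ring

lemma constC_eq (hq : 0 < r + lam) (hσd : 0 < σd) (hd : 0 < netRate r μd σd + lam) :
    constC r lam μd σd = mOne r lam μd σd * mTwo r lam μd σd /
      ((r + lam) * (mTwo r lam μd σd - mOne r lam μd σd) *
        (mOne r lam μd σd * (mOne r lam μd σd - 1))) := by
  have h1 := mOne_neg (μd := μd) hq hσd
  have h2 := one_lt_mTwo hq hσd hd
  have e := characteristic_eq_mul (μd := μd) hq hσd 1
  have e1 := (characteristic_eq_zero_iff (μd := μd) hq hσd (mTwo r lam μd σd)).2 (Or.inr rfl)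
  have hd' : netRate r μd σd + lam = -(σd ^ 2 / 2 * 1 ^ 2 + μd * 1 - (r + lam)) := by
    unfold netRate; ring
  rw [e] at hd'
  unfold constC
  rw [hd']
  generalize mOne r lam μd σd = m at *
  generalize mTwo r lam μd σd = n at *
  have : n * μd + n * σd ^ 2 / 2 - r - lam = σd ^ 2 / 2 * (n * (1 - n)) := by
    linear_combination e1
  rw [this]
  have : n - m ≠ 0 := by linarith
  have : m - 1 ≠ 0 := by linarith
  have : 1 - n ≠ 0 := by linarith
  have : 1 - m ≠ 0 := by linarith
  have : m ≠ 0 := by linarith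
  field_simp
  ring

lemma constB_neg (hq : 0 < r + lam) (hσd : 0 < σd) (hd : 0 < netRate r μd σd + lam) :
    constB r lam μd σd < 0 := by
  have h1 := mOne_neg (μd := μd) hq hσd
  have h2 := one_lt_mTwo hq hσd hd
  rw [constB_eq hq hσd hd]
  exact div_neg_of_neg_of_pos (mul_neg_of_neg_of_pos h1 (by linarith))
    (mul_pos (mul_pos hq (by linarith)) (mul_pos (by linarith) (by linarith)))

lemma constC_neg (hq : 0 < r + lam) (hσd : 0 < σd) (hd : 0 < netRate r μd σd + lam) :
    constC r lam μd σd < 0 := by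
  have h1 := mOne_neg (μd := μd) hq hσd
  have h2 := one_lt_mTwo hq hσd hd
  rw [constC_eq hq hσd hd]
  exact div_neg_of_neg_of_pos (mul_neg_of_neg_of_pos h1 (by linarith))
    (mul_pos (mul_pos hq (by linarith)) (mul_pos_of_neg_of_neg h1 (by linarith)))

lemma inv_netRate_add_eq (hq : 0 < r + lam) (hσd : 0 < σd) (hd : 0 < netRate r μd σd + lam) :
    1 / (netRate r μd σd + lam) = -(mOne r lam μd σd * mTwo r lam μd σd) /
      ((r + lam) * ((1 - mOne r lam μd σd) * (mTwo r lam μd σd - 1))) := by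
  have h1 := mOne_neg (μd := μd) hq hσd
  have h2 := one_lt_mTwo hq hσd hd
  have e := characteristic_eq_mul (μd := μd) hq hσd 1
  have e0 := characteristic_eq_mul (μd := μd) hq hσd 0
  have hd' : netRate r μd σd + lam = -(σd ^ 2 / 2 * 1 ^ 2 + μd * 1 - (r + lam)) := by
    unfold netRate; ring
  have hq' : r + lam = -(σd ^ 2 / 2 * 0 ^ 2 + μd * 0 - (r + lam)) := by ring
  rw [e] at hd'
  rw [e0] at hq'
  rw [hd', hq']
  generalize mOne r lam μd σd = m at *
  generalize mTwo r lam μd σd = n at *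
  have : n - 1 ≠ 0 := by linarith
  have : 1 - n ≠ 0 := by linarith
  have : 1 - m ≠ 0 := by linarith
  have : m ≠ 0 := by linarith
  have : n ≠ 0 := by linarith
  field_simp
  ring

end Roots

/-! ### Mean of a capped exponential under the Laplace law -/

section CappedExponential

open Set

lemma setIntegral_Ioi_exp_switch {p p' c A B : ℝ} (hp : p < 0) (hp' : p' < 0) (hc : 0 ≤ c)
    {f : ℝ → ℝ} (h1 : ∀ x, 0 < x → x ≤ c → f x = A * Real.exp (p * x))
    (h2 : ∀ x, c < x → f x = B * Real.exp (p' * x)) :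
    ∫ x in Ioi (0 : ℝ), f x =
      -A / p + (-B * Real.exp (p' * c) / p' + A * Real.exp (p * c) / p) := by
  -- One exponential on the whole half-line plus a correction beyond `c`: only half-line integrals
  -- are needed.
  have hf : EqOn f (fun x => A * Real.exp (p * x) +
      (Ioi c).indicator (fun x => B * Real.exp (p' * x) - A * Real.exp (p * x)) x) (Ioi 0) := by
    intro x hx
    by_cases hxc : x ≤ c
    · simp [h1 x hx hxc, hxc]
    · simp [h2 x (not_le.1 hxc), not_le.1 hxc]
  have i1 (z : ℝ) : IntegrableOn (fun x => A * Real.exp (p * x)) (Ioi z) :=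
    (integrableOn_exp_mul_Ioi hp z).const_mul A
  have i2 : IntegrableOn (fun x => B * Real.exp (p' * x)) (Ioi c) :=
    (integrableOn_exp_mul_Ioi hp' c).const_mul B
  have i3 : IntegrableOn (fun x => (Ioi c).indicator
      (fun x => B * Real.exp (p' * x) - A * Real.exp (p * x)) x) (Ioi 0) :=
    ((i2.sub (i1 c)).integrable_indicator measurableSet_Ioi).integrableOn
  rw [setIntegral_congr_fun measurableSet_Ioi hf, integral_add (i1 0) i3,
    setIntegral_indicator measurableSet_Ioi, inter_eq_right.2 (Ioi_subset_Ioi hc),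
    integral_sub i2 (i1 c), integral_const_mul, integral_const_mul, integral_const_mul,
    integral_exp_mul_Ioi hp, integral_exp_mul_Ioi hp', integral_exp_mul_Ioi hp]
  simp only [mul_zero, Real.exp_zero]
  ring

lemma setIntegral_Ioi_mul_exp {p A : ℝ} (hp : p < 0) {f : ℝ → ℝ}
    (h : ∀ x, 0 < x → f x = A * Real.exp (p * x)) : ∫ x in Ioi (0 : ℝ), f x = -A / p := by
  rw [setIntegral_Ioi_exp_switch hp hp le_rfl (fun x hx _ => h x hx) h]
  ring

lemma norm_min_mul_exp_le {d y : ℝ} (hd : 0 ≤ d) (hy : 0 ≤ y) (x : ℝ) :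
    ‖min (d * Real.exp x) y‖ ≤ y := by
  rw [Real.norm_of_nonneg (le_min (by positivity) hy)]
  exact min_le_right _ _

lemma integral_min_mul_exp_asymmetricLaplace {a b d y : ℝ} (ha : 0 < a) (hb : 1 < b)
    (hd : 0 ≤ d) (hy : 0 ≤ y) :
    ∫ x, min (d * Real.exp x) y ∂asymmetricLaplace a b =
      if d < y then
        a * b / (a + b) * (d * (1 / (1 + a) + 1 / (b - 1)) -
          y ^ (1 - b) * d ^ b * (1 / (b * (b - 1))))
      else y - a * b / (a + b) * (y ^ (1 + a) * d ^ (-a) * (1 / (a * (a + 1)))) := by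
  have hb0 : 0 < b := by linarith
  have := isProbabilityMeasure_expMeasure ha
  have := isProbabilityMeasure_expMeasure hb0
  rcases hy.eq_or_lt with rfl | hy'
  · have h0 : ∀ x, min (d * Real.exp x) 0 = 0 := fun x => min_eq_right (by positivity)
    simp [h0, hd.not_gt, Real.zero_rpow (show 1 + a ≠ 0 by linarith)]
  rcases hd.eq_or_lt with rfl | hd'
  · simp [hy, hy', Real.zero_rpow hb0.ne']
  have i (ν : Measure ℝ) [IsFiniteMeasure ν] (s : ℝ) :
      Integrable (fun x => min (d * Real.exp (s * x)) y) ν :=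
    Integrable.of_bound (by fun_prop) y (ae_of_all _ fun x => norm_min_mul_exp_le hd hy _)
  rw [integral_asymmetricLaplace ha hb0 (by simpa using i (expMeasure a) (-1))
    (by simpa using i (expMeasure b) 1), integral_expMeasure ha, integral_expMeasure hb0]
  clear i
  -- In logarithmic coordinates the cap becomes active at `x = Y - D`, and every power is an
  -- exponential.
  obtain ⟨D, rfl⟩ : ∃ D, d = Real.exp D := ⟨_, (Real.exp_log hd').symm⟩
  obtain ⟨Y, rfl⟩ : ∃ Y, y = Real.exp Y := ⟨_, (Real.exp_log hy').symm⟩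
  simp only [Real.exp_lt_exp, ← Real.exp_add, smul_eq_mul, ← Real.exp_mul]
  split_ifs with h
  · rw [setIntegral_Ioi_mul_exp (p := -(1 + a)) (A := a * Real.exp D) (by linarith) (by
        intro x hx
        rw [min_eq_left (Real.exp_le_exp.2 (by linarith)), mul_assoc, mul_assoc,
          ← Real.exp_add, ← Real.exp_add]
        ring_nf),
      setIntegral_Ioi_exp_switch (p := 1 - b) (p' := -b) (A := b * Real.exp D)
      (B := b * Real.exp Y) (c := Y - D) (by linarith) (by linarith) (by linarith) (by
        intro x hx hxc
        rw [min_eq_left (Real.exp_le_exp.2 (by linarith)), mul_assoc, mul_assoc,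
          ← Real.exp_add, ← Real.exp_add]
        ring_nf) (by
        intro x hx
        rw [min_eq_right (Real.exp_le_exp.2 (by linarith)), mul_assoc, mul_assoc,
          ← Real.exp_add, ← Real.exp_add]
        ring_nf)]
    have e1 : Real.exp Y * Real.exp (-(b * (Y - D))) = Real.exp (Y * (1 - b) + D * b) := by
      rw [← Real.exp_add]; ring_nf
    have e2 : Real.exp D * Real.exp ((1 - b) * (Y - D)) = Real.exp (Y * (1 - b) + D * b) := by
      rw [← Real.exp_add]; ring_nf
    rw [mul_assoc b, e2, neg_mul, neg_mul, mul_assoc b, e1]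
    have : 1 - b ≠ 0 := by linarith
    have : b - 1 ≠ 0 := by linarith
    field_simp
    ring
  · rw [setIntegral_Ioi_exp_switch (p := -a) (p' := -(1 + a)) (A := a * Real.exp Y)
      (B := a * Real.exp D) (c := D - Y) (by linarith) (by linarith) (by linarith) (by
        intro x hx hxc
        rw [min_eq_right (Real.exp_le_exp.2 (by linarith)), mul_assoc, mul_assoc,
          ← Real.exp_add, ← Real.exp_add]
        ring_nf) (by
        intro x hx
        rw [min_eq_left (Real.exp_le_exp.2 (by linarith)), mul_assoc, mul_assoc,
          ← Real.exp_add, ← Real.exp_add]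
        ring_nf),
      setIntegral_Ioi_mul_exp (p := -b) (A := b * Real.exp Y) (by linarith) (by
        intro x hx
        rw [min_eq_right (Real.exp_le_exp.2 (by linarith)), mul_assoc, mul_assoc,
          ← Real.exp_add, ← Real.exp_add]
        ring_nf)]
    have e1 : Real.exp D * Real.exp (-((1 + a) * (D - Y))) =
        Real.exp (Y * (1 + a) + D * (-a)) := by
      rw [← Real.exp_add]; ring_nf
    have e2 : Real.exp Y * Real.exp (-a * (D - Y)) = Real.exp (Y * (1 + a) + D * (-a)) := by
      rw [← Real.exp_add]; ring_nf
    rw [mul_assoc a, e2, neg_mul, neg_mul, mul_assoc a, e1]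
    field_simp
    ring

end CappedExponential

/-! ### C² gluing across the threshold -/

section Smoothness

lemma HasDerivAt.ite_lt {f g f' g' : ℝ → ℝ} {a : ℝ} (hf : ∀ x, HasDerivAt f (f' x) x)
    (hg : ∀ x, HasDerivAt g (g' x) x) (h : f a = g a) (h' : f' a = g' a) (x : ℝ) :
    HasDerivAt (fun x => if x < a then f x else g x) (if x < a then f' x else g' x) x := by
  rcases lt_trichotomy x a with hx | rfl | hx
  · rw [if_pos hx]
    refine (hf x).congr_of_eventuallyEq ?_
    filter_upwards [Iio_mem_nhds hx] with y hy using if_pos hy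
  · rw [if_neg (lt_irrefl x)]
    have h1 : HasDerivWithinAt (fun y => if y < x then f y else g y) (g' x) (Set.Iic x) x := by
      rw [← h']
      refine (hf x).hasDerivWithinAt.congr (fun y hy => ?_) (by simp [h])
      rcases (Set.mem_Iic.1 hy).lt_or_eq with hy | rfl
      · exact if_pos hy
      · simp [h]
    have h2 : HasDerivWithinAt (fun y => if y < x then f y else g y) (g' x) (Set.Ici x) x :=
      (hg x).hasDerivWithinAt.congr (fun y hy => if_neg (not_lt.2 hy)) (by simp)
    simpa [Set.Iic_union_Ici] using h1.union h2
  · rw [if_neg hx.not_gt]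
    refine (hg x).congr_of_eventuallyEq ?_
    filter_upwards [Ioi_mem_nhds hx] with y hy using if_neg (Set.mem_Ioi.1 hy).not_gt

lemma contDiff_two_ite_lt {f g f' g' f'' g'' : ℝ → ℝ} {a : ℝ}
    (hf : ∀ x, HasDerivAt f (f' x) x) (hg : ∀ x, HasDerivAt g (g' x) x)
    (hf' : ∀ x, HasDerivAt f' (f'' x) x) (hg' : ∀ x, HasDerivAt g' (g'' x) x)
    (hfc : Continuous f'') (hgc : Continuous g'')
    (h : f a = g a) (h' : f' a = g' a) (h'' : f'' a = g'' a) :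
    ContDiff ℝ 2 (fun x => if x < a then f x else g x) := by
  have d1 := HasDerivAt.ite_lt hf hg h h'
  have d2 := HasDerivAt.ite_lt hf' hg' h' h''
  rw [show (2 : WithTop ℕ∞) = 1 + 1 by norm_num, contDiff_succ_iff_deriv]
  refine ⟨fun x => (d1 x).differentiableAt, by simp, ?_⟩
  rw [funext fun x => (d1 x).deriv, contDiff_one_iff_deriv]
  refine ⟨fun x => (d2 x).differentiableAt, ?_⟩
  rw [funext fun x => (d2 x).deriv]
  refine Continuous.if (fun x hx => ?_) hfc hgc
  have : x = a := by
    have := frontier_lt_subset_eq continuous_id continuous_const hx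
    simpa using this
  rw [this, h'']

/-- The hypotheses match the value and first two derivatives at `0` of the profile `g` in `y g(log d
- log y)`; the threshold `d = y` corresponds to `0`. -/
lemma contDiffOn_homogeneous_ite {m n B C p q : ℝ} (h0 : B + p = C + q)
    (h1 : B * n + p = C * m) (h2 : B * n ^ 2 + p = C * m ^ 2) :
    ContDiffOn ℝ 2 (fun x : ℝ × ℝ × ℝ =>
      if x.2.2 < x.1 + x.2.1 then B * (x.1 + x.2.1) ^ (1 - n) * x.2.2 ^ n + x.2.2 * p
      else C * (x.1 + x.2.1) ^ (1 - m) * x.2.2 ^ m + (x.1 + x.2.1) * q)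
      {x | 0 < x.1 + x.2.1 ∧ 0 < x.2.2} := by
  have hexp (k c x : ℝ) : HasDerivAt (fun x => c * Real.exp (k * x))
      (c * k * Real.exp (k * x)) x := by
    have := (((hasDerivAt_id x).const_mul k).exp).const_mul c
    exact this.congr_deriv (by simp only [id, mul_one]; ring)
  have hexp1 (c x : ℝ) : HasDerivAt (fun x => Real.exp x * c) (Real.exp x * c) x :=
    (Real.hasDerivAt_exp x).mul_const c
  have key : ContDiff ℝ 2 (fun x : ℝ => if x < 0 then B * Real.exp (n * x) + Real.exp x * p
      else C * Real.exp (m * x) + q) := by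
    refine contDiff_two_ite_lt (fun x => (hexp n B x).add (hexp1 p x))
      (fun x => (hexp m C x).add_const q)
      (fun x => (hexp n (B * n) x).add (hexp1 p x)) (fun x => hexp m (C * m) x)
      (by fun_prop) (by fun_prop) ?_ ?_ ?_
    · simpa using h0
    · simpa using h1
    · simp only [mul_zero, Real.exp_zero]
      linarith
  have hlog : ContDiffOn ℝ 2 (fun x : ℝ × ℝ × ℝ => Real.log x.2.2 - Real.log (x.1 + x.2.1))
      {x | 0 < x.1 + x.2.1 ∧ 0 < x.2.2} :=
    (ContDiffOn.log (by fun_prop) fun x hx => hx.2.ne').sub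
      (ContDiffOn.log (by fun_prop) fun x hx => hx.1.ne')
  have hadd : ContDiffOn ℝ 2 (fun x : ℝ × ℝ × ℝ => x.1 + x.2.1)
      {x | 0 < x.1 + x.2.1 ∧ 0 < x.2.2} := by fun_prop
  refine (hadd.mul (key.comp_contDiffOn hlog)).congr fun x hx => ?_
  obtain ⟨hy, hd⟩ := hx
  simp only [Function.comp_apply, sub_neg, Real.log_lt_log_iff hd hy]
  generalize x.1 + x.2.1 = y at *
  generalize x.2.2 = d at *
  have hpow (k : ℝ) : y * Real.exp (k * (Real.log d - Real.log y)) = y ^ (1 - k) * d ^ k := by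
    nth_rw 1 [← Real.exp_log hy]
    rw [Real.rpow_def_of_pos hy, Real.rpow_def_of_pos hd, ← Real.exp_add, ← Real.exp_add]
    ring_nf
  have hpow1 : y * Real.exp (Real.log d - Real.log y) = d := by
    simpa using hpow 1
  split_ifs
  · linear_combination (-B) * hpow n - p * hpow1
  · linear_combination (-C) * hpow m

end Smoothness

/-! ### Reduction of the killed expectation to an exponential time -/

section Killing

open Set Filter Topology

/-- The random endpoint becomes an indicator of `s < τ`, over a fixed domain suited to Fubini. -/
lemma discountedSharedEnergy_eq {Ω : Type*} {W : ℝ≥0 → Ω → ℝ} {r μd σd : ℝ} {τ : Ω → ℝ}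
    {yh yb d : ℝ} {ω : Ω} (h : 0 ≤ τ ω) :
    discountedSharedEnergy W τ r μd σd yh yb d ω =
      ∫ s in Ioi (0 : ℝ), Real.exp (-r * s) * ((Ioi s).indicator (fun _ => 1) (τ ω) *
        min (d * Real.exp (μd * s.toNNReal + σd * W s.toNNReal ω)) (yh + yb)) := by
  rw [discountedSharedEnergy, intervalIntegral.integral_of_le h, integral_Ioc_eq_integral_Ioo,
    ← Ioi_inter_Iio, ← setIntegral_indicator measurableSet_Iio]
  refine setIntegral_congr_fun measurableSet_Ioi fun s _ => ?_
  by_cases hs : s < τ ω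
  · simp [hs, demand]
  · simp [hs]

variable {Ω : Type*} [MeasurableSpace Ω] {P : Measure Ω}

/-- Fubini needs joint measurability. Freezing time at `⌊tn⌋ / n` leaves countably many marginals,
and path continuity gives convergence almost everywhere. -/
lemma aemeasurable_uncurry_of_continuous_paths {X : ℝ≥0 → Ω → ℝ} [SFinite P]
    (hm : ∀ t, AEMeasurable (X t) P) (hc : ∀ᵐ ω ∂P, Continuous fun t => X t ω)
    (ν : Measure ℝ) [SFinite ν] :
    AEMeasurable (fun p : ℝ × Ω => X p.1.toNNReal p.2) (ν.prod P) := by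
  let f (n : ℕ) (p : ℝ × Ω) : ℝ := X ((⌊max p.1 0 * n⌋₊ : ℝ) / n).toNNReal p.2
  have hsnd : Tendsto Prod.snd (ae (ν.prod P)) (ae P) :=
    Measure.quasiMeasurePreserving_snd.tendsto_ae
  have hf (n : ℕ) : AEMeasurable (f n) (ν.prod P) := by
    have h1 : ∀ᵐ ω ∂P, ∀ k : ℕ, X ((k : ℝ) / n).toNNReal ω = (hm ((k : ℝ) / n).toNNReal).mk _ ω :=
      ae_all_iff.2 fun k => (hm _).ae_eq_mk
    have h2 : Measurable fun q : ℕ × Ω => (hm ((q.1 : ℝ) / n).toNNReal).mk _ q.2 :=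
      measurable_from_prod_countable_right fun k =>
        (hm ((k : ℝ) / n).toNNReal).measurable_mk
    have h3 : Measurable fun p : ℝ × Ω => (⌊max p.1 0 * n⌋₊, p.2) := by fun_prop
    refine ⟨_, h2.comp h3, ?_⟩
    filter_upwards [hsnd.eventually h1] with p hp using hp _
  refine aemeasurable_of_tendsto_metrizable_ae atTop hf ?_
  filter_upwards [hsnd.eventually hc] with p hp
  have h := (tendsto_nat_floor_mul_div_atTop (le_max_right p.1 0)).comp
    (tendsto_natCast_atTop_atTop (R := ℝ))
  have h' := (hp.tendsto _).comp ((continuous_real_toNNReal.tendsto _).comp h)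
  have e : (max p.1 0).toNNReal = p.1.toNNReal := by
    rw [Real.toNNReal, Real.toNNReal]; ext; simp
  rw [e] at h'
  exact h'

lemma integral_indicator_lt_expMeasure {lam s : ℝ} (hlam : 0 < lam) (hs : 0 ≤ s) :
    ∫ x, (Ioi s).indicator (fun _ => (1 : ℝ)) x ∂expMeasure lam = Real.exp (-lam * s) := by
  rw [integral_expMeasure hlam, setIntegral_Ioi_exp_switch (p := -lam) (p' := -lam) (A := 0)
    (B := lam) (c := s) (by linarith) (by linarith) hs (fun x _ hx => by simp [hx])
    (fun x hx => by simp [hx])]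
  field_simp
  ring

lemma ae_nonneg_of_hasLaw_expMeasure {lam : ℝ} {τ : Ω → ℝ} (hτ : HasLaw τ (expMeasure lam) P) :
    ∀ᵐ ω ∂P, 0 ≤ τ ω := by
  have h : ∀ᵐ x ∂expMeasure lam, 0 ≤ x := by
    rw [ae_iff]
    simp only [not_le]
    change expMeasure lam (Iio 0) = 0
    rw [expMeasure, gammaMeasure, withDensity_apply _ measurableSet_Iio]
    exact lintegral_gammaPDF_of_nonpos le_rfl
  rw [← hτ.map_eq] at h
  exact ae_of_ae_map hτ.aemeasurable h

variable {W : ℝ≥0 → Ω → ℝ} {r lam μd σd : ℝ} {τ : Ω → ℝ} {yh yb d : ℝ}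

lemma integrable_killed_prod [IsProbabilityMeasure P] (hW : IsBrownianReal W P) (hr : 0 < r)
    (hτ : AEMeasurable τ P)
    {y : ℝ} (hy : 0 ≤ y) (hd : 0 ≤ d) :
    Integrable (fun p : ℝ × Ω => Real.exp (-r * p.1) *
      ((Ioi p.1).indicator (fun _ => (1 : ℝ)) (τ p.2) *
        min (d * Real.exp (μd * p.1.toNNReal + σd * W p.1.toNNReal p.2)) y))
      ((volume.restrict (Ioi 0)).prod P) := by
  have h1 : Integrable (fun p : ℝ × Ω => Real.exp (-r * p.1) * y)
      ((volume.restrict (Ioi 0)).prod P) :=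
    (integrableOn_exp_mul_Ioi (neg_neg_of_pos hr) 0).mul_prod (integrable_const y)
  have hτ' : AEMeasurable (fun p : ℝ × Ω => τ p.2) ((volume.restrict (Ioi (0 : ℝ))).prod P) :=
    hτ.comp_quasiMeasurePreserving Measure.quasiMeasurePreserving_snd
  have hW' := aemeasurable_uncurry_of_continuous_paths (fun t => hW.aemeasurable t) hW.cont
    (volume.restrict (Ioi 0))
  have hi : AEMeasurable (fun p : ℝ × Ω => (Ioi p.1).indicator (fun _ => (1 : ℝ)) (τ p.2))
      ((volume.restrict (Ioi (0 : ℝ))).prod P) := by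
    have hm : Measurable fun q : ℝ × ℝ => (Ioi q.1).indicator (fun _ => (1 : ℝ)) q.2 :=
      (measurable_const (a := (1 : ℝ))).indicator (measurableSet_lt measurable_fst measurable_snd)
    exact hm.comp_aemeasurable (measurable_fst.aemeasurable.prodMk hτ')
  have hw : AEMeasurable (fun p : ℝ × Ω =>
      min (d * Real.exp (μd * p.1.toNNReal + σd * W p.1.toNNReal p.2)) y)
      ((volume.restrict (Ioi (0 : ℝ))).prod P) := by
    have hμ : Measurable fun p : ℝ × Ω => μd * p.1.toNNReal := by fun_prop
    exact ((hμ.aemeasurable.add (hW'.const_mul σd)).exp.const_mul d).min aemeasurable_const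
  have he : Measurable fun p : ℝ × Ω => Real.exp (-r * p.1) := by fun_prop
  refine h1.mono' (he.aemeasurable.mul (hi.mul hw)).aestronglyMeasurable
    (ae_of_all _ fun p => ?_)
  · rw [norm_mul, norm_mul, Real.norm_of_nonneg (Real.exp_pos _).le]
    refine mul_le_mul_of_nonneg_left ?_ (Real.exp_pos _).le
    refine (mul_le_mul (norm_indicator_le_norm_self _ _) (norm_min_mul_exp_le hd hy _)
      (norm_nonneg _) (by simp)).trans ?_
    simp

lemma integrable_discountedSharedEnergy [IsProbabilityMeasure P] (hW : IsBrownianReal W P)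
    (hr : 0 < r) (hτ : HasLaw τ (expMeasure lam) P) (hy : 0 ≤ yh + yb) (hd : 0 ≤ d) :
    Integrable (discountedSharedEnergy W τ r μd σd yh yb d) P := by
  refine (integrable_killed_prod (μd := μd) (σd := σd) hW hr hτ.aemeasurable
    hy hd).integral_prod_right.congr ?_
  filter_upwards [ae_nonneg_of_hasLaw_expMeasure hτ] with ω hω
    using (discountedSharedEnergy_eq hω).symm

/-- Independence splits off the survival probability `P(τ > s) = e^{-λs}`. -/
lemma integral_killed_min (hW : IsBrownianReal W P) (hlam : 0 < lam)
    (hτ : HasLaw τ (expMeasure lam) P) (hind : IndepFun τ (fun ω t => W t ω) P)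
    (y : ℝ) {s : ℝ} (hs : 0 ≤ s) :
    ∫ ω, (Ioi s).indicator (fun _ => (1 : ℝ)) (τ ω) *
        min (d * Real.exp (μd * s.toNNReal + σd * W s.toNNReal ω)) y ∂P =
      Real.exp (-lam * s) *
        ∫ x, min (d * Real.exp (μd * s + σd * x)) y ∂gaussianReal 0 s.toNNReal := by
  have hmi : Measurable ((Ioi s).indicator fun _ => (1 : ℝ)) :=
    measurable_const.indicator measurableSet_Ioi
  have hmm : Measurable fun x : ℝ => min (d * Real.exp (μd * s + σd * x)) y := by fun_prop
  have hi : IndepFun (fun ω => (Ioi s).indicator (fun _ => (1 : ℝ)) (τ ω))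
      (fun ω => min (d * Real.exp (μd * s + σd * W s.toNNReal ω)) y) P :=
    hind.comp hmi (hmm.comp (measurable_pi_apply s.toNNReal))
  have hlW := hW.hasLaw_eval s.toNNReal
  rw [Real.coe_toNNReal s hs, hi.integral_fun_mul_eq_mul_integral
    (hmi.comp_aemeasurable hτ.aemeasurable).aestronglyMeasurable
    (hmm.comp_aemeasurable hlW.aemeasurable).aestronglyMeasurable,
    ← integral_indicator_lt_expMeasure hlam hs]
  congr 1
  · exact hτ.integral_comp hmi.aestronglyMeasurable
  · exact hlW.integral_comp hmm.aestronglyMeasurable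

lemma incentive_eq_integral_exponentialTimeLaw [IsProbabilityMeasure P]
    (hW : IsBrownianReal W P) (hr : 0 < r) (hlam : 0 < lam) (hτ : HasLaw τ (expMeasure lam) P)
    (hind : IndepFun τ (fun ω t => W t ω) P) (hy : 0 ≤ yh + yb) (hd : 0 ≤ d) :
    incentive P W τ r μd σd yh yb d =
      (r + lam)⁻¹ * ∫ x, min (d * Real.exp x) (yh + yb) ∂exponentialTimeLaw (r + lam) μd σd := by
  have hq : 0 < r + lam := add_pos hr hlam
  rw [incentive, integral_congr_ae ((ae_nonneg_of_hasLaw_expMeasure hτ).mono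
    fun ω hω => discountedSharedEnergy_eq hω), ← integral_integral_swap
    (integrable_killed_prod hW hr hτ.aemeasurable hy hd),
    integral_exponentialTimeLaw hq μd σd
      (by fun_prop : Continuous fun x => min (d * Real.exp x) (yh + yb)).stronglyMeasurable
      (norm_min_mul_exp_le hd hy), integral_expMeasure hq, ← integral_const_mul]
  refine setIntegral_congr_fun measurableSet_Ioi fun s hs => ?_
  rw [integral_const_mul, integral_killed_min hW hlam hτ hind _ (le_of_lt hs), smul_eq_mul,
    ← mul_assoc, ← mul_assoc, inv_mul_cancel_left₀ hq.ne', ← Real.exp_add]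
  ring_nf

lemma incentive_eq [IsProbabilityMeasure P] (hW : IsBrownianReal W P) (hr : 0 < r)
    (hlam : 0 < lam) (hσd : 0 < σd)
    (hrd : 0 < netRate r μd σd) (hτ : HasLaw τ (expMeasure lam) P)
    (hind : IndepFun τ (fun ω t => W t ω) P) (hy : 0 ≤ yh + yb) (hd : 0 ≤ d) :
    incentive P W τ r μd σd yh yb d =
      if d < yh + yb then
        constB r lam μd σd * (yh + yb) ^ (1 - mTwo r lam μd σd) * d ^ mTwo r lam μd σd
          + d / (netRate r μd σd + lam)
      else
        constC r lam μd σd * (yh + yb) ^ (1 - mOne r lam μd σd) * d ^ mOne r lam μd σd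
          + (yh + yb) / (r + lam) := by
  have hq : 0 < r + lam := add_pos hr hlam
  have hD : 0 < netRate r μd σd + lam := add_pos hrd hlam
  have h1 := mOne_neg (μd := μd) hq hσd
  have h2 := one_lt_mTwo hq hσd hD
  have hs := mOne_add_mTwo (r := r) (lam := lam) (μd := μd) hσd
  have hp := mOne_mul_mTwo (r := r) (lam := lam) (μd := μd) hq hσd
  rw [incentive_eq_integral_exponentialTimeLaw hW hr hlam hτ hind hy hd,
    exponentialTimeLaw_eq_asymmetricLaplace (a := -mOne r lam μd σd) (b := mTwo r lam μd σd) hq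
      (by linarith) (by linarith)
      (by field_simp at hp; linear_combination (-1 / 2) * hp)
      (by field_simp at hs; linear_combination (-1 / 2) * hs),
    integral_min_mul_exp_asymmetricLaplace (by linarith) h2 hd hy, constB_eq hq hσd hD,
    constC_eq hq hσd hD, div_eq_mul_one_div d, inv_netRate_add_eq hq hσd hD, neg_neg,
    ← sub_eq_add_neg]
  generalize mOne r lam μd σd = m at *
  generalize mTwo r lam μd σd = n at *
  have : n - 1 ≠ 0 := by linarith
  have : 1 - m ≠ 0 := by linarith
  have : m - 1 ≠ 0 := by linarith
  have : -m + 1 ≠ 0 := by linarith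
  have : n - m ≠ 0 := by linarith
  have : -m + n ≠ 0 := by linarith
  have : m ≠ 0 := by linarith
  have : n ≠ 0 := by linarith
  split_ifs
  · generalize (yh + yb) ^ (1 - n) = u
    generalize d ^ n = v
    field_simp
    ring
  · generalize (yh + yb) ^ (1 - m) = u
    generalize d ^ m = v
    field_simp
    ring

end Killing

lemma contDiffOn_incentive {Ω : Type*} [MeasurableSpace Ω] {P : Measure Ω} [IsProbabilityMeasure P]
    {W : ℝ≥0 → Ω → ℝ} (hW : IsBrownianReal W P)
    {r lam μd σd : ℝ} (hr : 0 < r) (hlam : 0 < lam) (hσd : 0 < σd)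
    (hrd : 0 < netRate r μd σd)
    {τ : Ω → ℝ} (hτ : HasLaw τ (expMeasure lam) P)
    (hind : IndepFun τ (fun ω t => W t ω) P) :
    ContDiffOn ℝ 2
      (fun p : ℝ × ℝ × ℝ => incentive P W τ r μd σd p.1 p.2.1 p.2.2)
      {p : ℝ × ℝ × ℝ | 0 < p.1 + p.2.1 ∧ 0 < p.2.2} := by
  have hq : 0 < r + lam := add_pos hr hlam
  have hD : 0 < netRate r μd σd + lam := add_pos hrd hlam
  have h1 := mOne_neg (μd := μd) hq hσd
  have h2 := one_lt_mTwo hq hσd hD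
  have hB := constB_eq hq hσd hD
  have hC := constC_eq hq hσd hD
  have hI := inv_netRate_add_eq hq hσd hD
  refine (contDiffOn_homogeneous_ite (B := constB r lam μd σd) (C := constC r lam μd σd)
    (n := mTwo r lam μd σd) (m := mOne r lam μd σd) (p := 1 / (netRate r μd σd + lam))
    (q := 1 / (r + lam)) ?_ ?_ ?_).congr fun p hp => ?_
  rotate_left 3
  · rw [incentive_eq hW hr hlam hσd hrd hτ hind hp.1.le hp.2.le]
    simp only [mul_one_div]
  -- The three matching conditions, now rational identities in `m` and `n`.
  all_goals
    rw [hB, hC, hI]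
    generalize mOne r lam μd σd = m at *
    generalize mTwo r lam μd σd = n at *
    have : n - 1 ≠ 0 := by linarith
    have : 1 - m ≠ 0 := by linarith
    have : m - 1 ≠ 0 := by linarith
    have : n - m ≠ 0 := by linarith
    have : m ≠ 0 := by linarith
    have : n ≠ 0 := by linarith
    field_simp
    ring

theorem mainTheorem1 {Ω : Type*} [MeasurableSpace Ω] (P : Measure Ω) [IsProbabilityMeasure P]
    (W : ℝ≥0 → Ω → ℝ) (hW : IsBrownianReal W P)
    (r lam μd σd : ℝ) (hr : 0 < r) (hlam : 0 < lam) (hσd : 0 < σd)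
    (hrd : 0 < netRate r μd σd)
    (τ : Ω → ℝ) (hτ : HasLaw τ (expMeasure lam) P)
    (hind : IndepFun τ (fun ω t => W t ω) P) :
    (∀ x : ℝ, σd ^ 2 / 2 * x ^ 2 + μd * x - (r + lam) = 0 ↔
      x = mOne r lam μd σd ∨ x = mTwo r lam μd σd) ∧
    mOne r lam μd σd < 0 ∧ 1 < mTwo r lam μd σd ∧
    constB r lam μd σd < 0 ∧ constC r lam μd σd < 0 ∧
    (∀ yh yb d : ℝ, 0 ≤ yh → 0 ≤ yb → 0 ≤ d →
      Integrable (discountedSharedEnergy W τ r μd σd yh yb d) P ∧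
      incentive P W τ r μd σd yh yb d =
        if d < yh + yb then
          constB r lam μd σd * (yh + yb) ^ (1 - mTwo r lam μd σd) * d ^ mTwo r lam μd σd
            + d / (netRate r μd σd + lam)
        else
          constC r lam μd σd * (yh + yb) ^ (1 - mOne r lam μd σd) * d ^ mOne r lam μd σd
            + (yh + yb) / (r + lam)) ∧
    ContDiffOn ℝ 2
      (fun p : ℝ × ℝ × ℝ => incentive P W τ r μd σd p.1 p.2.1 p.2.2)
      {p : ℝ × ℝ × ℝ | 0 ≤ p.1 ∧ 0 ≤ p.2.1 ∧ 0 < p.1 + p.2.1 ∧ 0 < p.2.2} := by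
  have hq : 0 < r + lam := add_pos hr hlam
  have hD : 0 < netRate r μd σd + lam := add_pos hrd hlam
  exact ⟨characteristic_eq_zero_iff hq hσd, mOne_neg hq hσd, one_lt_mTwo hq hσd hD,
    constB_neg hq hσd hD, constC_neg hq hσd hD,
    fun yh yb d hyh hyb hd =>
      ⟨integrable_discountedSharedEnergy hW hr hτ (add_nonneg hyh hyb) hd,
        incentive_eq hW hr hlam hσd hrd hτ hind (add_nonneg hyh hyb) hd⟩,
    -- Smoothness holds on an open set containing the faces `yh = 0` and `yb = 0` of the domain, so
    -- restriction suffices.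
    (contDiffOn_incentive hW hr hlam hσd hrd hτ hind).mono fun p hp => hp.2.2⟩
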